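/- Let $X$ be a nonempty countable set and let $G=(X,b)$ be a connected graph over $X$, that is, $b\colon X\times X\to[0,\infty)$ is symmetric, vanishes on the diagonal, satisfies $\deg(x):=\sum_{y}b(x,y)<\infty$ for all $x\in X$, and any two vertices can be joined by a finite path of edges, where $x\sim y$ iff $b(x,y)>0$. For $f\colon X\to\mathbb R$ let $Q(f)=\frac12\sum_{x,y\in X}b(x,y)|f(x)-f(y)|^2\in[0,\infty]$; $f$ has finite energy if $Q(f)<\infty$. The graph is *recurrent* if for $o\in X$ the constant function $1$ lies in the closure of the finitely supported functions with respect to the norm $\|f\|_o=(Q(f)+|f(o)|^2)^{1/2}$ on the functions of finite energy (this does not depend on $o$), and *transient* otherwise. A finite measure on $X$ is a function $m\colon X\to(0,\infty)$ with $\sum_x m(x)<\infty$. A metric $\sigma$ on $X$ is *intrinsic* with respect to $m$ if $\frac12\sum_{y}b(x,y)\sigma(x,y)^2\le m(x)$ for all $x\in X$. For $U\subseteq X$ let $$\mathrm{cap}_m(U)=\inf\Big\{Q(f)+\sum_{x}m(x)|f(x)|^2 \;:\; f\colon X\to\mathbb R,\ Q(f)<\infty,\ \sum_x m(x)|f(x)|^2<\infty,\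 f\ge 1\text{ on }U\Big\}$$ (with $\inf\emptyset=\infty$), and for a subset $A$ of the completion $\overline X^\sigma$ of $(X,\sigma)$ let $\mathrm{cap}_m(A)=\inf\{\mathrm{cap}_m(O\cap X) : O\subseteq\overline X^\sigma\text{ open},\ A\subseteq O\}$. Put $\partial_\sigma X=\overline X^\sigma\setminus X$. A metric $\sigma$ on $X$ is a *resolving metric* for $G$ if it induces the discrete topology on $X$ and there is a finite measure $m$ with respect to which $\sigma$ is intrinsic and $\mathrm{cap}_m(\{p\})=0$ for every $p\in\partial_\sigma X$. The graph $G$ is *strongly resolvable* if it has a resolving metric. A function $f\colon X\to\mathbb R$ is *harmonic* if $f(x)=\frac1{\deg(x)}\sum_{y}b(x,y)f(y)$ for all $x\in X$, with absolutely convergent sums. Suppose that $G$ is transient and strongly resolvable, and that at least one of the following holds: (a) $G$ is locally finite, i.e. $\{y\in X: y\sim x\}$ is finite for every $x\in X$; (b) there is a resolving metric $\sigma$ for $G$ such that $(X,\sigma)$ is totally bounded. Then the real vector space of bounded harmonic functions $f\colon X\to\mathbb R$ of finite energy is infinite dimensional. -/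

import Mathlib

open scoped ENNReal

/-- A weighted graph on the vertex set `X`: a symmetric edge weight `b : X × X → [0, ∞)` that
vanishes on the diagonal and has finite weighted vertex degrees. -/
structure WeightedGraph (X : Type*) where
  b : X → X → ℝ
  nonneg : ∀ x y, 0 ≤ b x y
  symm : ∀ x y, b x y = b y x
  diag : ∀ x, b x x = 0
  summable : ∀ x, Summable (b x)

namespace WeightedGraph

variable {X : Type*}

/-- The weighted vertex degree. -/
noncomputable def deg (G : WeightedGraph X) (x : X) : ℝ := ∑' y, G.b x y

/-- The underlying simple graph: `x ∼ y` iff `b x y > 0`. -/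
def toSimpleGraph (G : WeightedGraph X) : SimpleGraph X where
  Adj x y := 0 < G.b x y
  symm := ⟨fun x y h => by rw [G.symm y x]; exact h⟩
  loopless := ⟨fun x h => by rw [G.diag x] at h; exact lt_irrefl _ h⟩

/-- Any two vertices are joined by a finite path (and there is at least one vertex). -/
def IsConnected (G : WeightedGraph X) : Prop := G.toSimpleGraph.Connected

/-- Every vertex has finitely many neighbors. -/
def IsLocallyFinite (G : WeightedGraph X) : Prop := ∀ x, {y | G.toSimpleGraph.Adj x y}.Finite

/-- The Dirichlet energy `Q(f) = 1/2 ∑_{x,y} b(x,y) |f(x) - f(y)|²`, with values in `[0, ∞]`. -/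
noncomputable def energy (G : WeightedGraph X) (f : X → ℝ) : ℝ≥0∞ :=
  (∑' x, ∑' y, ENNReal.ofReal (G.b x y * (f x - f y) ^ 2)) / 2

/-- Functions of finite energy. -/
def HasFiniteEnergy (G : WeightedGraph X) (f : X → ℝ) : Prop := G.energy f < ∞

/-- `‖f‖_o² = Q(f) + |f(o)|²`. -/
noncomputable def pointedNormSq (G : WeightedGraph X) (o : X) (f : X → ℝ) : ℝ≥0∞ :=
  G.energy f + ENNReal.ofReal (|f o| ^ 2)

/-- `f` lies in the closure `𝔇₀(G)` of the finitely supported functions in the functions of finite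
energy, with respect to `‖·‖_o` (for connected graphs the choice of `o` is immaterial). -/
def MemClosureFinSupp (G : WeightedGraph X) (f : X → ℝ) : Prop :=
  G.HasFiniteEnergy f ∧ ∀ o : X, ∀ ε : ℝ≥0∞, 0 < ε →
    ∃ g : X → ℝ, (Function.support g).Finite ∧ G.pointedNormSq o (f - g) < ε

/-- `G` is recurrent if the constant function `1` belongs to `𝔇₀(G)`. -/
def IsRecurrent (G : WeightedGraph X) : Prop := G.MemClosureFinSupp (fun _ => 1)

def IsTransient (G : WeightedGraph X) : Prop := ¬ G.IsRecurrent

/-- A finite measure of full support on the discrete set `X`, given by its point masses. -/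
def IsFiniteWeight (m : X → ℝ) : Prop := (∀ x, 0 < m x) ∧ Summable m

/-- The metric is intrinsic with respect to `m`: `1/2 ∑_y b(x,y) σ(x,y)² ≤ m(x)` for all `x`. -/
def IsIntrinsic (G : WeightedGraph X) (m : X → ℝ) (_σ : MetricSpace X) : Prop :=
  ∀ x, (∑' y, ENNReal.ofReal (G.b x y * dist x y ^ 2)) / 2 ≤ ENNReal.ofReal (m x)

/-- `‖f‖²_{Q,m} = ‖f‖²_{ℓ²(X,m)} + Q(f)`, with values in `[0, ∞]`. -/
noncomputable def sobolevNormSq (G : WeightedGraph X) (m : X → ℝ) (f : X → ℝ) : ℝ≥0∞ :=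
  (∑' x, ENNReal.ofReal (m x * |f x| ^ 2)) + G.energy f

/-- `f ∈ H¹(G, m) = ℓ²(X, m) ∩ 𝔇(G)`. -/
def MemH1 (G : WeightedGraph X) (m : X → ℝ) (f : X → ℝ) : Prop :=
  (∑' x, ENNReal.ofReal (m x * |f x| ^ 2)) < ∞ ∧ G.HasFiniteEnergy f

/-- The capacity of a set of vertices (`∞` if there is no admissible function). -/
noncomputable def cap (G : WeightedGraph X) (m : X → ℝ) (U : Set X) : ℝ≥0∞ :=
  ⨅ (f : X → ℝ) (_ : G.MemH1 m f) (_ : ∀ x ∈ U, 1 ≤ f x), G.sobolevNormSq m f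

/-- The capacity of a subset of the metric completion. -/
noncomputable def capCompletion (G : WeightedGraph X) (m : X → ℝ) (_σ : MetricSpace X)
    (A : Set (UniformSpace.Completion X)) : ℝ≥0∞ :=
  ⨅ (O : Set (UniformSpace.Completion X)) (_ : IsOpen O) (_ : A ⊆ O),
    G.cap m ((fun x : X => (x : UniformSpace.Completion X)) ⁻¹' O)

/-- The metric boundary: the points of the completion that do not come from `X`. -/
def metricBoundary (_σ : MetricSpace X) : Set (UniformSpace.Completion X) :=
  (Set.range (fun x : X => (x : UniformSpace.Completion X)))ᶜ

/-- `σ` is a resolving metric: it induces the discrete topology and, for some finite measure `m`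
with respect to which it is intrinsic, all boundary points have capacity zero. -/
def IsResolvingMetric (G : WeightedGraph X) (σ : MetricSpace X) : Prop :=
  DiscreteTopology X ∧ ∃ m : X → ℝ, IsFiniteWeight m ∧ G.IsIntrinsic m σ ∧
    ∀ p ∈ metricBoundary σ, G.capCompletion m σ {p} = 0

def IsStronglyResolvable (G : WeightedGraph X) : Prop :=
  ∃ σ : MetricSpace X, G.IsResolvingMetric σ

/-- `f(x) ≥ 1/deg(x) ∑_y b(x,y) f(y)` for all `x`, with absolutely convergent sums. -/
def IsSuperharmonic (G : WeightedGraph X) (f : X → ℝ) : Prop :=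
  ∀ x, Summable (fun y => G.b x y * f y) ∧ 1 / G.deg x * ∑' y, G.b x y * f y ≤ f x

def IsHarmonic (G : WeightedGraph X) (f : X → ℝ) : Prop :=
  G.IsSuperharmonic f ∧ G.IsSuperharmonic (-f)

theorem isHarmonic_iff (G : WeightedGraph X) (f : X → ℝ) : G.IsHarmonic f ↔
    ∀ x, Summable (fun y => G.b x y * f y) ∧ 1 / G.deg x * ∑' y, G.b x y * f y = f x := by
  constructor
  · rintro ⟨h1, h2⟩ x
    refine ⟨(h1 x).1, le_antisymm (h1 x).2 ?_⟩
    have h := (h2 x).2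
    simp only [Pi.neg_apply, mul_neg, tsum_neg] at h
    linarith
  · intro h
    refine ⟨fun x => ⟨(h x).1, (h x).2.le⟩, fun x => ⟨?_, ?_⟩⟩
    · simpa using (h x).1.neg
    · simp only [Pi.neg_apply, mul_neg, tsum_neg]
      linarith [(h x).2]

theorem energy_add_le (G : WeightedGraph X) (f g : X → ℝ) :
    G.energy (f + g) ≤ 2 * G.energy f + 2 * G.energy g := by
  unfold energy
  rw [← mul_div_assoc, ← mul_div_assoc, ← ENNReal.add_div]
  gcongr
  rw [← ENNReal.tsum_mul_left, ← ENNReal.tsum_mul_left, ← ENNReal.tsum_add]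
  gcongr with x
  rw [← ENNReal.tsum_mul_left, ← ENNReal.tsum_mul_left, ← ENNReal.tsum_add]
  gcongr with y
  have hb := G.nonneg x y
  rw [show (2 : ℝ≥0∞) = ENNReal.ofReal 2 by simp, ← ENNReal.ofReal_mul (by norm_num),
    ← ENNReal.ofReal_mul (by norm_num), ← ENNReal.ofReal_add (by positivity) (by positivity)]
  apply ENNReal.ofReal_le_ofReal
  simp only [Pi.add_apply]
  nlinarith [mul_nonneg hb (sq_nonneg ((f x - f y) - (g x - g y)))]

theorem energy_smul (G : WeightedGraph X) (c : ℝ) (f : X → ℝ) :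
    G.energy (c • f) = ENNReal.ofReal (c ^ 2) * G.energy f := by
  unfold energy
  rw [← mul_div_assoc, ← ENNReal.tsum_mul_left]
  congr 2
  funext x
  rw [← ENNReal.tsum_mul_left]
  congr 1
  funext y
  rw [← ENNReal.ofReal_mul (sq_nonneg c)]
  congr 1
  simp only [Pi.smul_apply, smul_eq_mul]
  ring

/-- The real vector space of bounded harmonic functions of finite energy. -/
def boundedHarmonicFiniteEnergy (G : WeightedGraph X) : Submodule ℝ (X → ℝ) where
  carrier := {f | G.IsHarmonic f ∧ G.HasFiniteEnergy f ∧ ∃ C : ℝ, ∀ x, |f x| ≤ C}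
  zero_mem' := by
    refine ⟨(G.isHarmonic_iff 0).2 fun x => ?_, ?_, 0, fun x => ?_⟩
    · simp [summable_zero]
    · simp [HasFiniteEnergy, energy]
    · simp
  add_mem' := by
    rintro f g ⟨hf, ef, C, hC⟩ ⟨hg, eg, D, hD⟩
    rw [isHarmonic_iff] at hf hg
    refine ⟨(G.isHarmonic_iff _).2 fun x => ?_, ?_, C + D, fun x => ?_⟩
    · simp only [Pi.add_apply, mul_add]
      refine ⟨(hf x).1.add (hg x).1, ?_⟩
      rw [(hf x).1.tsum_add (hg x).1, mul_add, (hf x).2, (hg x).2]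
    · exact lt_of_le_of_lt (G.energy_add_le f g) (ENNReal.add_lt_top.2
        ⟨ENNReal.mul_lt_top (by simp) ef, ENNReal.mul_lt_top (by simp) eg⟩)
    · exact (abs_add_le _ _).trans (add_le_add (hC x) (hD x))
  smul_mem' := by
    rintro c f ⟨hf, ef, C, hC⟩
    rw [isHarmonic_iff] at hf
    refine ⟨(G.isHarmonic_iff _).2 fun x => ?_, ?_, |c| * C, fun x => ?_⟩
    · simp only [Pi.smul_apply, smul_eq_mul, mul_left_comm _ c]
      refine ⟨(hf x).1.mul_left c, ?_⟩
      rw [tsum_mul_left, mul_left_comm, (hf x).2]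
    · unfold HasFiniteEnergy
      rw [energy_smul]
      exact ENNReal.mul_lt_top (by simp) ef
    · simp only [Pi.smul_apply, smul_eq_mul, abs_mul]
      exact mul_le_mul_of_nonneg_left (hC x) (abs_nonneg c)

end WeightedGraph

/-! The argument is by contraposition: if the space H of bounded harmonic functions of finite energy
is finite dimensional, then 1 lies in 𝔇₀, the closure of the finitely supported functions. Two tools
carry it. By the Royden decomposition, every bounded f of finite energy is h + f₀ with h in H and f₀
in 𝔇₀ (`exists_harmonic_sub_memClosureFinSupp`). Moreover, 𝔇₀ is an order ideal among functions of
finite energy (`MemClosureFinSupp.of_abs_le`).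

Near a point p of capacity zero (`exists_isOpen_memClosureFinSupp`): for open U containing p, let
V(U) ⊆ H consist of the functions agreeing off U with an element of 𝔇₀. V is monotone, so finite
dimension yields a U with V(U) ⊆ V(O) for every open O containing p. If η is bounded, of finite
energy and zero off U, its harmonic part h lies in V(U), hence in V(O) for O of arbitrarily small
capacity. A cutoff e of small energy with e = 1 on O makes (1 - e)h an element of 𝔇₀ close to h.
Thus h, and with it η, is in 𝔇₀.

Globally (`isRecurrent_of_finiteDimensional`): every point of the completion now has a neighborhood
on which some nonnegative element of 𝔇₀ is at least 1, namely a Lipschitz bump or the indicator of a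
vertex. Because ∑ b σ² < ∞, there are functions v of arbitrarily small energy, zero at a base point
and equal to 1 off a totally bounded set (`exists_energy_lt_totallyBounded`). By compactness a
finite sum of the local functions dominates 1 - v, so 1 - v is in 𝔇₀, and v → 0 gives 1 in 𝔇₀. -/

open Filter Topology

namespace WeightedGraph

variable {X : Type*}

/-! ### Calculus of the Dirichlet energy -/

theorem energy_eq_tsum_prod (G : WeightedGraph X) (f : X → ℝ) :
    G.energy f = (∑' p : X × X, ENNReal.ofReal (G.b p.1 p.2 * (f p.1 - f p.2) ^ 2)) / 2 := by
  rw [energy, ENNReal.tsum_prod (f := fun x y => ENNReal.ofReal (G.b x y * (f x - f y) ^ 2))]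

theorem energy_mono (G : WeightedGraph X) {f g : X → ℝ}
    (h : ∀ x y, |f x - f y| ≤ |g x - g y|) : G.energy f ≤ G.energy g := by
  unfold energy
  gcongr ?_ / 2
  exact ENNReal.tsum_le_tsum fun x => ENNReal.tsum_le_tsum fun y => ENNReal.ofReal_le_ofReal
    (mul_le_mul_of_nonneg_left (sq_le_sq.2 (h x y)) (G.nonneg x y))

theorem two_mul_energy (G : WeightedGraph X) (f : X → ℝ) :
    2 * G.energy f = ∑' p : X × X, ENNReal.ofReal (G.b p.1 p.2 * (f p.1 - f p.2) ^ 2) := by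
  rw [energy_eq_tsum_prod, ENNReal.mul_div_cancel (by simp) (by simp)]

theorem energy_neg (G : WeightedGraph X) (f : X → ℝ) : G.energy (-f) = G.energy f := by
  apply le_antisymm <;> refine G.energy_mono fun x y => le_of_eq ?_ <;>
    · simp only [Pi.neg_apply]
      rw [abs_sub_comm]
      congr 1
      ring

/-- Young's inequality with a weight. A small t keeps the coefficient of the first energy near 1
when the second energy tends to 0. -/
theorem energy_add_le_mul (G : WeightedGraph X) (f g : X → ℝ) {t : ℝ} (ht : 0 < t) :
    G.energy (f + g) ≤
      ENNReal.ofReal (1 + t) * G.energy f + ENNReal.ofReal (1 + t⁻¹) * G.energy g := by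
  unfold energy
  rw [← mul_div_assoc, ← mul_div_assoc, ← ENNReal.add_div]
  gcongr
  rw [← ENNReal.tsum_mul_left, ← ENNReal.tsum_mul_left, ← ENNReal.tsum_add]
  gcongr with x
  rw [← ENNReal.tsum_mul_left, ← ENNReal.tsum_mul_left, ← ENNReal.tsum_add]
  gcongr with y
  have hb := G.nonneg x y
  rw [← ENNReal.ofReal_mul (by positivity), ← ENNReal.ofReal_mul (by positivity),
    ← ENNReal.ofReal_add (by positivity) (by positivity)]
  apply ENNReal.ofReal_le_ofReal
  simp only [Pi.add_apply]
  have key : (1 + t) * (f x - f y) ^ 2 + (1 + t⁻¹) * (g x - g y) ^ 2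
      - (f x + g x - (f y + g y)) ^ 2 = t⁻¹ * (t * (f x - f y) - (g x - g y)) ^ 2 := by
    field_simp
    ring
  have := mul_nonneg hb (mul_nonneg (inv_pos.2 ht).le
    (sq_nonneg (t * (f x - f y) - (g x - g y))))
  rw [← key] at this
  linarith

/-- This identity makes energy-minimising sequences Cauchy. -/
theorem energy_parallelogram (G : WeightedGraph X) (f g : X → ℝ) :
    G.energy (f - g) + G.energy (f + g) = 2 * G.energy f + 2 * G.energy g := by
  unfold energy
  rw [← mul_div_assoc, ← mul_div_assoc, ← ENNReal.add_div, ← ENNReal.add_div]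
  congr 1
  rw [← ENNReal.tsum_mul_left, ← ENNReal.tsum_mul_left, ← ENNReal.tsum_add, ← ENNReal.tsum_add]
  congr 1
  funext x
  rw [← ENNReal.tsum_mul_left, ← ENNReal.tsum_mul_left, ← ENNReal.tsum_add, ← ENNReal.tsum_add]
  congr 1
  funext y
  have hb := G.nonneg x y
  rw [show (2 : ℝ≥0∞) = ENNReal.ofReal 2 by simp, ← ENNReal.ofReal_mul (by norm_num),
    ← ENNReal.ofReal_mul (by norm_num), ← ENNReal.ofReal_add (by positivity) (by positivity),
    ← ENNReal.ofReal_add (by positivity) (by positivity)]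
  congr 1
  simp only [Pi.add_apply, Pi.sub_apply]
  ring

/-- Lower semicontinuity of the energy under pointwise convergence. -/
theorem energy_le_of_tendsto (G : WeightedGraph X) {f : ℕ → X → ℝ} {f₀ : X → ℝ}
    (hf : ∀ x, Tendsto (fun n => f n x) atTop (𝓝 (f₀ x))) {c : ℕ → ℝ≥0∞} {c₀ : ℝ≥0∞}
    (hc : Tendsto c atTop (𝓝 c₀)) (h : ∀ n, G.energy (f n) ≤ c n) : G.energy f₀ ≤ c₀ := by
  simp only [energy_eq_tsum_prod] at h ⊢
  rw [ENNReal.tsum_eq_iSup_sum, ENNReal.iSup_div]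
  refine iSup_le fun s => ?_
  refine le_of_tendsto_of_tendsto' (ENNReal.Tendsto.div_const (tendsto_finsetSum s
    (f := fun p n => ENNReal.ofReal (G.b p.1 p.2 * (f n p.1 - f n p.2) ^ 2)) fun p _ => ?_)
    (Or.inr (by simp))) hc fun n => ?_
  · exact (ENNReal.continuous_ofReal.tendsto _).comp
      ((((hf p.1).sub (hf p.2)).pow 2).const_mul _)
  · refine le_trans ?_ (h n)
    gcongr
    exact ENNReal.sum_le_tsum s

theorem energy_add_lt_top (G : WeightedGraph X) {f g : X → ℝ} (hf : G.HasFiniteEnergy f)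
    (hg : G.HasFiniteEnergy g) : G.HasFiniteEnergy (f + g) :=
  (G.energy_add_le f g).trans_lt (ENNReal.add_lt_top.2
    ⟨ENNReal.mul_lt_top (by simp) hf, ENNReal.mul_lt_top (by simp) hg⟩)

theorem energy_sub_lt_top (G : WeightedGraph X) {f g : X → ℝ} (hf : G.HasFiniteEnergy f)
    (hg : G.HasFiniteEnergy g) : G.HasFiniteEnergy (f - g) := by
  rw [sub_eq_add_neg]
  exact G.energy_add_lt_top hf (by unfold HasFiniteEnergy; rwa [energy_neg])

theorem energy_smul_lt_top (G : WeightedGraph X) {f : X → ℝ} (c : ℝ) (hf : G.HasFiniteEnergy f) :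
    G.HasFiniteEnergy (c • f) := by
  unfold HasFiniteEnergy
  rw [energy_smul]
  exact ENNReal.mul_lt_top (by simp) hf

/-- A function whose increments are bounded by those of two functions of finite energy has
finite energy. -/
theorem energy_le_of_abs_sub_le (G : WeightedGraph X) {f g k : X → ℝ}
    (h : ∀ x y, |f x - f y| ≤ |g x - g y| + |k x - k y|) :
    G.energy f ≤ 2 * G.energy g + 2 * G.energy k := by
  unfold energy
  rw [← mul_div_assoc, ← mul_div_assoc, ← ENNReal.add_div]
  gcongr
  rw [← ENNReal.tsum_mul_left, ← ENNReal.tsum_mul_left, ← ENNReal.tsum_add]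
  gcongr with x
  rw [← ENNReal.tsum_mul_left, ← ENNReal.tsum_mul_left, ← ENNReal.tsum_add]
  gcongr with y
  have hb := G.nonneg x y
  rw [show (2 : ℝ≥0∞) = ENNReal.ofReal 2 by simp, ← ENNReal.ofReal_mul (by norm_num),
    ← ENNReal.ofReal_mul (by norm_num), ← ENNReal.ofReal_add (by positivity) (by positivity)]
  apply ENNReal.ofReal_le_ofReal
  have h1 : (f x - f y) ^ 2 ≤ 2 * (g x - g y) ^ 2 + 2 * (k x - k y) ^ 2 := by
    rw [← sq_abs (f x - f y), ← sq_abs (g x - g y), ← sq_abs (k x - k y)]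
    nlinarith [h x y, abs_nonneg (f x - f y), sq_nonneg (|g x - g y| - |k x - k y|)]
  nlinarith [mul_le_mul_of_nonneg_left h1 hb]

/-- Since (f x - f y)² ≤ 2 f(x)² + 2 f(y)², finiteness of the weighted degrees on the support is
enough. -/
theorem hasFiniteEnergy_of_finite_support (G : WeightedGraph X) {f : X → ℝ}
    (hf : (Function.support f).Finite) : G.HasFiniteEnergy f := by
  have hfin : ∑' x, ∑' y, ENNReal.ofReal (G.b x y * (2 * f x ^ 2)) < ∞ := by
    have h1 : ∀ x, ∑' y, ENNReal.ofReal (G.b x y * (2 * f x ^ 2)) < ∞ := fun x => by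
      rw [← ENNReal.ofReal_tsum_of_nonneg
        (fun y => mul_nonneg (G.nonneg x y) (by positivity)) ((G.summable x).mul_right _)]
      exact ENNReal.ofReal_lt_top
    rw [tsum_eq_sum (s := hf.toFinset)]
    · exact ENNReal.sum_lt_top.2 fun x _ => h1 x
    · intro x hx
      have : f x = 0 := by simpa using hx
      simp [this]
  have hfin' : ∑' x, ∑' y, ENNReal.ofReal (G.b x y * (2 * f y ^ 2)) < ∞ := by
    rw [ENNReal.tsum_comm]
    simpa only [G.symm] using hfin
  refine lt_of_le_of_lt ?_ (ENNReal.add_lt_top.2 ⟨hfin, hfin'⟩)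
  refine (ENNReal.div_le_of_le_mul (le_mul_of_one_le_right' (by norm_num))).trans ?_
  rw [← ENNReal.tsum_add]
  gcongr with x
  rw [← ENNReal.tsum_add]
  gcongr with y
  have hb := G.nonneg x y
  rw [← ENNReal.ofReal_add (by positivity) (by positivity)]
  apply ENNReal.ofReal_le_ofReal
  nlinarith [mul_nonneg hb (sq_nonneg (f x + f y))]

/-- Dominated convergence for energies. -/
theorem tendsto_energy_zero_of_dominated (G : WeightedGraph X) {r s : ℕ → X → ℝ} {a c : X → ℝ}
    (hr : ∀ x, Tendsto (fun n => r n x) atTop (𝓝 0)) (ha : G.HasFiniteEnergy a)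
    (hc : G.HasFiniteEnergy c) (hs : Tendsto (fun n => G.energy (s n)) atTop (𝓝 0))
    (h : ∀ n x y, |r n x - r n y| ≤ |a x - a y| + |c x - c y| + |s n x - s n y|) :
    Tendsto (fun n => G.energy (r n)) atTop (𝓝 0) := by
  let A : X × X → ℝ := fun p => |a p.1 - a p.2| + |c p.1 - c p.2|
  -- The squared increment of `r n` is at most twice its truncation at `A p ^ 2` plus twice the
  -- squared increment of `s n`. The truncated part has a summable majorant, so dominated
  -- convergence for counting measure applies to it.
  let u : ℕ → X × X → ℝ≥0∞ := fun n p =>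
    ENNReal.ofReal (G.b p.1 p.2 * min ((r n p.1 - r n p.2) ^ 2) (A p ^ 2))
  have hA : ∑' p : X × X, ENNReal.ofReal (G.b p.1 p.2 * A p ^ 2) ≠ ∞ := by
    have h2 : (∑' p : X × X, ENNReal.ofReal (G.b p.1 p.2 * A p ^ 2)) ≤
        2 * (2 * G.energy a) + 2 * (2 * G.energy c) := by
      rw [two_mul_energy, two_mul_energy, ← ENNReal.tsum_mul_left, ← ENNReal.tsum_mul_left,
        ← ENNReal.tsum_add]
      gcongr with p
      have hb := G.nonneg p.1 p.2
      rw [show (2 : ℝ≥0∞) = ENNReal.ofReal 2 by simp, ← ENNReal.ofReal_mul (by norm_num),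
        ← ENNReal.ofReal_mul (by norm_num), ← ENNReal.ofReal_add (by positivity) (by positivity)]
      apply ENNReal.ofReal_le_ofReal
      have : A p ^ 2 ≤ 2 * (a p.1 - a p.2) ^ 2 + 2 * (c p.1 - c p.2) ^ 2 := by
        rw [← sq_abs (a p.1 - a p.2), ← sq_abs (c p.1 - c p.2)]
        simp only [A]
        nlinarith [sq_nonneg (|a p.1 - a p.2| - |c p.1 - c p.2|)]
      nlinarith [mul_le_mul_of_nonneg_left this hb]
    refine (h2.trans_lt ?_).ne
    exact ENNReal.add_lt_top.2
      ⟨ENNReal.mul_lt_top (by simp) (ENNReal.mul_lt_top (by simp) ha),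
        ENNReal.mul_lt_top (by simp) (ENNReal.mul_lt_top (by simp) hc)⟩
  have hu : Tendsto (fun n => ∑' p, u n p) atTop (𝓝 0) := by
    let _ : MeasurableSpace (X × X) := ⊤
    have := MeasureTheory.tendsto_lintegral_of_dominated_convergence
      (μ := MeasureTheory.Measure.count) (F := u) (f := fun _ => 0)
      (fun p : X × X => ENNReal.ofReal (G.b p.1 p.2 * A p ^ 2)) (fun n => measurable_from_top)
      (fun n => Eventually.of_forall fun p => ?_)
      (by rwa [MeasureTheory.lintegral_count]) (Eventually.of_forall fun p => ?_)
    · simpa [MeasureTheory.lintegral_count] using this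
    · apply ENNReal.ofReal_le_ofReal
      exact mul_le_mul_of_nonneg_left (min_le_right _ _) (G.nonneg _ _)
    · have h0 : Tendsto (fun n => G.b p.1 p.2 * min ((r n p.1 - r n p.2) ^ 2) (A p ^ 2)) atTop
          (𝓝 (G.b p.1 p.2 * min ((0 - 0) ^ 2) (A p ^ 2))) :=
        ((((hr p.1).sub (hr p.2)).pow 2).min tendsto_const_nhds).const_mul _
      have h1 : G.b p.1 p.2 * min ((0 - 0 : ℝ) ^ 2) (A p ^ 2) = 0 := by
        rw [min_eq_left (by simpa using sq_nonneg (A p))]; simp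
      rw [h1] at h0
      simpa [u, Function.comp_def] using (ENNReal.continuous_ofReal.tendsto _).comp h0
  have hlim : Tendsto (fun n => 2 * ∑' p, u n p + 2 * (2 * G.energy (s n))) atTop (𝓝 0) := by
    simpa using (ENNReal.Tendsto.const_mul hu (Or.inr ENNReal.ofNat_ne_top)).add
      (ENNReal.Tendsto.const_mul (ENNReal.Tendsto.const_mul hs (Or.inr ENNReal.ofNat_ne_top))
        (Or.inr ENNReal.ofNat_ne_top))
  refine tendsto_of_tendsto_of_tendsto_of_le_of_le tendsto_const_nhds hlim (fun _ => zero_le)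
    fun n => ?_
  refine (le_mul_of_one_le_left' (by norm_num : (1 : ℝ≥0∞) ≤ 2)).trans ?_
  rw [two_mul_energy, two_mul_energy, ← ENNReal.tsum_mul_left, ← ENNReal.tsum_mul_left,
    ← ENNReal.tsum_add]
  gcongr with p
  have hb := G.nonneg p.1 p.2
  rw [show (2 : ℝ≥0∞) = ENNReal.ofReal 2 by simp, ← ENNReal.ofReal_mul (by norm_num),
    ← ENNReal.ofReal_mul (by norm_num), ← ENNReal.ofReal_add (by positivity) (by positivity)]
  apply ENNReal.ofReal_le_ofReal
  have h5 : (r n p.1 - r n p.2) ^ 2 ≤ 2 * min ((r n p.1 - r n p.2) ^ 2) (A p ^ 2)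
      + 2 * (s n p.1 - s n p.2) ^ 2 := by
    have := h n p.1 p.2
    rcases min_cases ((r n p.1 - r n p.2) ^ 2) (A p ^ 2) with ⟨e, _⟩ | ⟨e, _⟩
    · rw [e]; nlinarith [sq_nonneg (r n p.1 - r n p.2), sq_nonneg (s n p.1 - s n p.2)]
    · rw [e, ← sq_abs (r n p.1 - r n p.2), ← sq_abs (s n p.1 - s n p.2)]
      change |r n p.1 - r n p.2| ≤ A p + |s n p.1 - s n p.2| at this
      nlinarith [abs_nonneg (r n p.1 - r n p.2), sq_nonneg (A p - |s n p.1 - s n p.2|)]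
  nlinarith [mul_le_mul_of_nonneg_left h5 hb]

/-- A single edge term is bounded by twice the energy, so small energy controls the increment across
each edge; connectedness then propagates convergence from one vertex to all. -/
theorem tendsto_sub_of_tendsto_energy (G : WeightedGraph X) {r : ℕ → X → ℝ}
    (hr : Tendsto (fun n => G.energy (r n)) atTop (𝓝 0)) {x y : X} (hxy : 0 < G.b x y) :
    Tendsto (fun n => r n x - r n y) atTop (𝓝 0) := by
  have h1 : Tendsto (fun n => ENNReal.ofReal (G.b x y * (r n x - r n y) ^ 2)) atTop (𝓝 0) := by
    have h2 : Tendsto (fun n => 2 * G.energy (r n)) atTop (𝓝 0) := by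
      simpa using ENNReal.Tendsto.const_mul hr (Or.inr ENNReal.ofNat_ne_top)
    refine tendsto_of_tendsto_of_tendsto_of_le_of_le tendsto_const_nhds h2 (fun _ => zero_le)
      fun n => ?_
    simp only [two_mul_energy]
    exact ENNReal.le_tsum
      (f := fun p : X × X => ENNReal.ofReal (G.b p.1 p.2 * (r n p.1 - r n p.2) ^ 2)) (x, y)
  have h3 : Tendsto (fun n => G.b x y * (r n x - r n y) ^ 2) atTop (𝓝 0) := by
    have := (ENNReal.tendsto_toReal ENNReal.zero_ne_top).comp h1
    refine this.congr fun n => ?_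
    exact ENNReal.toReal_ofReal (mul_nonneg hxy.le (sq_nonneg _))
  have h4 : Tendsto (fun n => (r n x - r n y) ^ 2) atTop (𝓝 0) := by
    have := h3.const_mul (G.b x y)⁻¹
    rw [mul_zero] at this
    refine this.congr fun n => ?_
    field_simp
  have h5 := (Real.continuous_sqrt.tendsto _).comp h4
  rw [Real.sqrt_zero] at h5
  exact (tendsto_zero_iff_abs_tendsto_zero _).2 (h5.congr fun n => Real.sqrt_sq_eq_abs _)

theorem tendsto_zero_of_tendsto_energy (G : WeightedGraph X) (hconn : G.IsConnected)
    {r : ℕ → X → ℝ} (hr : Tendsto (fun n => G.energy (r n)) atTop (𝓝 0)) {o : X}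
    (ho : Tendsto (fun n => r n o) atTop (𝓝 0)) (x : X) :
    Tendsto (fun n => r n x) atTop (𝓝 0) := by
  obtain ⟨w⟩ := hconn.preconnected o x
  induction w with
  | nil => exact ho
  | cons h _ ih =>
    refine ih ?_
    simpa using ho.sub (G.tendsto_sub_of_tendsto_energy hr h)

/-! ### The space 𝔇₀: closedness, linearity and the ideal property -/

theorem memClosureFinSupp_of_finite_support (G : WeightedGraph X) {f : X → ℝ}
    (hf : (Function.support f).Finite) : G.MemClosureFinSupp f := by
  refine ⟨G.hasFiniteEnergy_of_finite_support hf, fun o ε hε => ⟨f, hf, ?_⟩⟩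
  simpa [pointedNormSq, energy] using hε

theorem pointedNormSq_add_le (G : WeightedGraph X) (o : X) (f g : X → ℝ) :
    G.pointedNormSq o (f + g) ≤ 2 * G.pointedNormSq o f + 2 * G.pointedNormSq o g := by
  have h : ENNReal.ofReal (|(f + g) o| ^ 2) ≤
      2 * ENNReal.ofReal (|f o| ^ 2) + 2 * ENNReal.ofReal (|g o| ^ 2) := by
    rw [show (2 : ℝ≥0∞) = ENNReal.ofReal 2 by simp, ← ENNReal.ofReal_mul (by norm_num),
      ← ENNReal.ofReal_mul (by norm_num), ← ENNReal.ofReal_add (by positivity) (by positivity)]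
    apply ENNReal.ofReal_le_ofReal
    simp only [Pi.add_apply, sq_abs]
    nlinarith [sq_nonneg (f o - g o)]
  unfold pointedNormSq
  calc _ ≤ (2 * G.energy f + 2 * G.energy g) +
      (2 * ENNReal.ofReal (|f o| ^ 2) + 2 * ENNReal.ofReal (|g o| ^ 2)) :=
        add_le_add (G.energy_add_le f g) h
    _ = _ := by ring

/-- `𝔇₀(G)` is closed. -/
theorem memClosureFinSupp_of_tendsto (G : WeightedGraph X) {f : X → ℝ} {g : ℕ → X → ℝ}
    (hg : ∀ n, G.MemClosureFinSupp (g n))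
    (h : Tendsto (fun n => G.energy (f - g n)) atTop (𝓝 0))
    (h' : ∀ x, Tendsto (fun n => g n x) atTop (𝓝 (f x))) : G.MemClosureFinSupp f := by
  refine ⟨?_, fun o ε hε => ?_⟩
  · obtain ⟨n, hn⟩ := (h.eventually (gt_mem_nhds ENNReal.zero_lt_top)).exists
    have := G.energy_add_lt_top (f := f - g n) hn (hg n).1
    rwa [sub_add_cancel] at this
  · have hlim : Tendsto (fun n => 2 * G.pointedNormSq o (f - g n)) atTop (𝓝 0) := by
      have h1 : Tendsto (fun n => ENNReal.ofReal (|(f - g n) o| ^ 2)) atTop (𝓝 0) := by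
        have := (((h' o).const_sub (f o)).abs).pow 2
        rw [sub_self, abs_zero, zero_pow two_ne_zero] at this
        simpa [Function.comp_def] using (ENNReal.continuous_ofReal.tendsto _).comp this
      simpa [pointedNormSq] using
        ENNReal.Tendsto.const_mul (h.add h1) (Or.inr (ENNReal.ofNat_ne_top (n := 2)))
    have hε2 : 0 < ε / 2 := ENNReal.half_pos hε.ne'
    obtain ⟨n, hn⟩ := (hlim.eventually (gt_mem_nhds hε2)).exists
    obtain ⟨k, hk, hk'⟩ := (hg n).2 o (ε / 4) (ENNReal.div_pos hε.ne' (by simp))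
    refine ⟨k, hk, ?_⟩
    have h2 : 2 * G.pointedNormSq o (g n - k) ≤ ε / 2 := by
      calc _ ≤ 2 * (ε / 4) := by gcongr
        _ = ε / 2 := by
          rw [show (4 : ℝ≥0∞) = 2 * 2 by norm_num, ENNReal.div_eq_inv_mul,
            ENNReal.mul_inv (by simp) (by simp), ← mul_assoc, ← mul_assoc,
            ENNReal.mul_inv_cancel (by simp) (by simp), one_mul, ENNReal.div_eq_inv_mul]
    have h3 := G.pointedNormSq_add_le o (f - g n) (g n - k)
    rw [sub_add_sub_cancel] at h3
    by_cases htop : ε = ∞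
    · subst htop
      refine h3.trans_lt (ENNReal.add_lt_top.2 ⟨hn.trans_le le_top, ?_⟩)
      refine ENNReal.mul_lt_top (by simp) (hk'.trans_le le_top)
    · calc _ ≤ _ := h3
        _ < ε / 2 + ε / 2 := ENNReal.add_lt_add_of_lt_of_le
          (h2.trans_lt (ENNReal.div_lt_top htop (by simp))).ne hn h2
        _ = ε := ENNReal.add_halves ε

theorem MemClosureFinSupp.exists_tendsto {G : WeightedGraph X} (hconn : G.IsConnected)
    {f : X → ℝ} (hf : G.MemClosureFinSupp f) : ∃ g : ℕ → X → ℝ,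
      (∀ n, (Function.support (g n)).Finite) ∧
      Tendsto (fun n => G.energy (f - g n)) atTop (𝓝 0) ∧
      ∀ x, Tendsto (fun n => g n x) atTop (𝓝 (f x)) := by
  obtain ⟨o⟩ := hconn.nonempty
  have hpos : ∀ n : ℕ, (0 : ℝ≥0∞) < (n + 1 : ℝ≥0∞)⁻¹ := fun n =>
    ENNReal.inv_pos.2 (by finiteness)
  choose g hg hg' using fun n : ℕ => hf.2 o _ (hpos n)
  have hlim : Tendsto (fun n : ℕ => (n + 1 : ℝ≥0∞)⁻¹) atTop (𝓝 0) := by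
    have := (tendsto_add_atTop_iff_nat 1).2 ENNReal.tendsto_inv_nat_nhds_zero
    simpa using this
  have h1 : Tendsto (fun n => G.energy (f - g n)) atTop (𝓝 0) :=
    tendsto_of_tendsto_of_tendsto_of_le_of_le tendsto_const_nhds hlim (fun _ => zero_le)
      fun n => le_self_add.trans (hg' n).le
  have h2 : Tendsto (fun n => ENNReal.ofReal (|(f - g n) o| ^ 2)) atTop (𝓝 0) :=
    tendsto_of_tendsto_of_tendsto_of_le_of_le tendsto_const_nhds hlim (fun _ => zero_le)
      fun n => le_add_self.trans (hg' n).le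
  have h3 : Tendsto (fun n => (f - g n) o) atTop (𝓝 0) := by
    have h4 := (Real.continuous_sqrt.tendsto _).comp
      ((ENNReal.tendsto_toReal ENNReal.zero_ne_top).comp h2)
    rw [ENNReal.toReal_zero, Real.sqrt_zero] at h4
    refine (tendsto_zero_iff_abs_tendsto_zero _).2 (h4.congr fun n => ?_)
    simp only [Function.comp_apply]
    rw [ENNReal.toReal_ofReal (by positivity), Real.sqrt_sq (abs_nonneg _)]
  refine ⟨g, hg, h1, fun x => ?_⟩
  simpa using (G.tendsto_zero_of_tendsto_energy hconn h1 h3 x).const_sub (f x)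

theorem MemClosureFinSupp.add {G : WeightedGraph X} (hconn : G.IsConnected) {f g : X → ℝ}
    (hf : G.MemClosureFinSupp f) (hg : G.MemClosureFinSupp g) : G.MemClosureFinSupp (f + g) := by
  obtain ⟨u, hu, hu1, hu2⟩ := hf.exists_tendsto hconn
  obtain ⟨v, hv, hv1, hv2⟩ := hg.exists_tendsto hconn
  refine G.memClosureFinSupp_of_tendsto (g := fun n => u n + v n) (fun n =>
    G.memClosureFinSupp_of_finite_support (((hu n).union (hv n)).subset
      (Function.support_add _ _))) ?_ fun x => (hu2 x).add (hv2 x)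
  have hlim : Tendsto (fun n => 2 * G.energy (f - u n) + 2 * G.energy (g - v n)) atTop (𝓝 0) := by
    simpa using (ENNReal.Tendsto.const_mul hu1 (Or.inr (ENNReal.ofNat_ne_top (n := 2)))).add
      (ENNReal.Tendsto.const_mul hv1 (Or.inr (ENNReal.ofNat_ne_top (n := 2))))
  refine tendsto_of_tendsto_of_tendsto_of_le_of_le tendsto_const_nhds hlim (fun _ => zero_le)
    fun n => ?_
  change G.energy (f + g - (u n + v n)) ≤ _
  rw [add_sub_add_comm]
  exact G.energy_add_le _ _

theorem MemClosureFinSupp.smul {G : WeightedGraph X} (hconn : G.IsConnected) (c : ℝ) {f : X → ℝ}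
    (hf : G.MemClosureFinSupp f) : G.MemClosureFinSupp (c • f) := by
  obtain ⟨u, hu, hu1, hu2⟩ := hf.exists_tendsto hconn
  refine G.memClosureFinSupp_of_tendsto (g := fun n => c • u n) (fun n =>
    G.memClosureFinSupp_of_finite_support ((hu n).subset
      (Function.support_const_smul_subset _ _))) ?_ fun x => (hu2 x).const_mul c
  simp only [← smul_sub, energy_smul]
  simpa using ENNReal.Tendsto.const_mul hu1 (Or.inr (ENNReal.ofReal_ne_top (r := c ^ 2)))

theorem memClosureFinSupp_sum {G : WeightedGraph X} (hconn : G.IsConnected) {ι : Type*}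
    (s : Finset ι) (f : ι → X → ℝ) (hf : ∀ i ∈ s, G.MemClosureFinSupp (f i)) :
    G.MemClosureFinSupp (∑ i ∈ s, f i) := by
  classical
  induction s using Finset.induction_on with
  | empty => exact G.memClosureFinSupp_of_finite_support (by simp)
  | insert i s his ih =>
    rw [Finset.sum_insert his]
    exact (hf i (by simp)).add hconn (ih fun j hj => hf j (by simp [hj]))

/-- Clamping a to [-|c|, |c|] is 1-Lipschitz in (a, c) for the sup norm. -/
theorem abs_max_min_sub_le (a b c d : ℝ) :
    |max (min a |c|) (-|c|) - max (min b |d|) (-|d|)| ≤ |a - b| + |c - d| := by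
  have h1 : |max (min a |c|) (-|c|) - max (min b |d|) (-|d|)| ≤ max |a - b| |c - d| := by
    have hcd := abs_abs_sub_abs_le c d
    refine (abs_max_sub_max_le_max _ _ _ _).trans (max_le
      ((abs_min_sub_min_le_max _ _ _ _).trans (max_le_max le_rfl hcd)) (le_max_of_le_right ?_))
    rw [neg_sub_neg, abs_sub_comm]
    exact hcd
  exact h1.trans (max_le_add_of_nonneg (abs_nonneg _) (abs_nonneg _))

/-- `𝔇₀(G)` is an order ideal in the functions of finite energy. -/
theorem MemClosureFinSupp.of_abs_le {G : WeightedGraph X} (hconn : G.IsConnected) {f g : X → ℝ}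
    (hg : G.MemClosureFinSupp g) (hf : G.HasFiniteEnergy f) (h : ∀ x, |f x| ≤ |g x|) :
    G.MemClosureFinSupp f := by
  obtain ⟨u, hu, hu1, hu2⟩ := hg.exists_tendsto hconn
  -- Clamping f between ±|u n| forces finite support, and the limit is still f because |f| ≤ |g|.
  let v : ℕ → X → ℝ := fun n x => max (min (f x) |u n x|) (-|u n x|)
  have hv : ∀ x, Tendsto (fun n => v n x) atTop (𝓝 (f x)) := fun x => by
    have h1 := (tendsto_const_nhds (x := f x)).min (hu2 x).abs |>.max (hu2 x).abs.neg
    have h2 := abs_le.1 (h x)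
    rwa [min_eq_left h2.2, max_eq_left h2.1] at h1
  refine G.memClosureFinSupp_of_tendsto (g := v) (fun n =>
    G.memClosureFinSupp_of_finite_support ((hu n).subset fun x hx => ?_)) ?_ hv
  · rw [Function.mem_support] at hx ⊢
    contrapose! hx
    simp [v, hx]
  -- The increments of f - v n are at most 2|Δf| + |Δ(u n)|, and |Δ(u n)| ≤ |Δg| + |Δ(g - u n)|.
  -- Hence the dominating pair 2f, g and the vanishing remainder g - u n.
  · refine G.tendsto_energy_zero_of_dominated (a := (2 : ℝ) • f) (c := g)
      (s := fun n => g - u n) (fun x => ?_) (G.energy_smul_lt_top _ hf) hg.1 hu1 fun n x y => ?_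
    · simpa using (hv x).const_sub (f x)
    · have h1 := abs_max_min_sub_le (f x) (f y) (u n x) (u n y)
      have h2 : |u n x - u n y| ≤ |g x - g y| + |(g - u n) x - (g - u n) y| := by
        refine le_trans (le_of_eq ?_) (abs_sub _ _)
        simp only [Pi.sub_apply]
        congr 1
        ring
      have h3 : |(f - v n) x - (f - v n) y| ≤ |f x - f y| + |v n x - v n y| := by
        refine le_trans (le_of_eq ?_) (abs_sub _ _)
        simp only [Pi.sub_apply]
        congr 1
        ring
      have h4 : |((2 : ℝ) • f) x - ((2 : ℝ) • f) y| = 2 * |f x - f y| := by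
        simp only [Pi.smul_apply, smul_eq_mul, ← mul_sub, abs_mul]
        simp
      rw [h4]
      linarith

/-! ### Energy minimisers, harmonicity and the Royden decomposition -/

theorem HasFiniteEnergy.summable {G : WeightedGraph X} {f : X → ℝ} (hf : G.HasFiniteEnergy f) :
    Summable fun p : X × X => G.b p.1 p.2 * (f p.1 - f p.2) ^ 2 := by
  have h1 : 2 * G.energy f ≠ ∞ := (ENNReal.mul_lt_top (by simp) hf).ne
  rw [two_mul_energy] at h1
  refine (ENNReal.summable_toReal h1).congr fun p => ?_
  exact ENNReal.toReal_ofReal (mul_nonneg (G.nonneg _ _) (sq_nonneg _))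

theorem HasFiniteEnergy.two_mul_energy_eq {G : WeightedGraph X} {f : X → ℝ}
    (hf : G.HasFiniteEnergy f) :
    2 * G.energy f = ENNReal.ofReal (∑' p : X × X, G.b p.1 p.2 * (f p.1 - f p.2) ^ 2) := by
  rw [two_mul_energy, ENNReal.ofReal_tsum_of_nonneg
    (fun p => mul_nonneg (G.nonneg _ _) (sq_nonneg _)) hf.summable]

theorem summable_mul_of_bounded (G : WeightedGraph X) {f : X → ℝ} {C : ℝ}
    (hC : ∀ x, |f x| ≤ C) (x : X) : Summable fun y => G.b x y * f y := by
  refine Summable.of_norm_bounded ((G.summable x).mul_right C) fun y => ?_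
  rw [Real.norm_eq_abs, abs_mul, abs_of_nonneg (G.nonneg x y)]
  exact mul_le_mul_of_nonneg_left (hC y) (G.nonneg x y)

/-- A bounded minimiser of the energy under finitely supported perturbations is harmonic. -/
theorem isHarmonic_of_energy_le (G : WeightedGraph X) (hdeg : ∀ x, G.deg x ≠ 0) {h : X → ℝ}
    {C : ℝ} (hC : ∀ x, |h x| ≤ C) (hfin : G.HasFiniteEnergy h)
    (hmin : ∀ ψ : X → ℝ, (Function.support ψ).Finite → G.energy h ≤ G.energy (h + ψ)) :
    G.IsHarmonic h := by
  classical
  refine (G.isHarmonic_iff h).2 fun x => ?_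
  have hsum := G.summable_mul_of_bounded hC x
  refine ⟨hsum, ?_⟩
  let δ : X → ℝ := Pi.single x 1
  have hδ : (Function.support δ).Finite := (Set.finite_singleton x).subset
    Pi.support_single_subset
  have hδfin := G.hasFiniteEnergy_of_finite_support hδ
  have hT : HasSum (fun y => G.b x y * (h x - h y)) (G.deg x * h x - ∑' y, G.b x y * h y) := by
    simp only [mul_sub]
    exact ((G.summable x).hasSum.mul_right (h x)).sub hsum.hasSum
  -- T is the first variation of the energy at h in direction δ, up to a constant factor; T = 0 is
  -- harmonicity at x.
  set T := G.deg x * h x - ∑' y, G.b x y * h y with hTdef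
  have h1 : HasSum (fun p : X × X => G.b p.1 p.2 * (h p.1 - h p.2) * δ p.1) T := by
    have hi : Function.Injective fun y : X => (x, y) := Prod.mk_right_injective x
    refine (hi.hasSum_iff fun p hp => ?_).1 (by simpa [Function.comp_def, δ] using hT)
    have : p.1 ≠ x := fun e => hp ⟨p.2, by rw [← e]⟩
    simp [δ, this]
  have h2 : HasSum (fun p : X × X => G.b p.1 p.2 * (h p.1 - h p.2) * δ p.2) (-T) := by
    have hi : Function.Injective fun y : X => (y, x) := Prod.mk_left_injective x
    refine (hi.hasSum_iff fun p hp => ?_).1 ?_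
    · have : p.2 ≠ x := fun e => hp ⟨p.1, by rw [← e]⟩
      simp [δ, this]
    · refine Eq.subst (motive := fun k => HasSum k (-T)) (funext fun y => ?_) hT.neg
      simp [δ, G.symm y x]
      ring
  have hB : HasSum (fun p : X × X => G.b p.1 p.2 * (h p.1 - h p.2) * (δ p.1 - δ p.2))
      (2 * T) := by
    have h3 := h1.sub h2
    rw [show T - -T = 2 * T by ring] at h3
    simpa only [mul_sub] using h3
  set D := ∑' p : X × X, G.b p.1 p.2 * (δ p.1 - δ p.2) ^ 2 with hD
  have hD0 : 0 ≤ D := tsum_nonneg fun p => mul_nonneg (G.nonneg _ _) (sq_nonneg _)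
  have hvar : ∀ t : ℝ, 0 ≤ t * (4 * T) + t ^ 2 * D := fun t => by
    have hfin' := G.energy_add_lt_top hfin (G.energy_smul_lt_top t hδfin)
    have hle : 2 * G.energy h ≤ 2 * G.energy (h + t • δ) := by
      gcongr
      exact hmin _ (hδ.subset (Function.support_const_smul_subset _ _))
    rw [hfin.two_mul_energy_eq, hfin'.two_mul_energy_eq, ENNReal.ofReal_le_ofReal_iff
      (tsum_nonneg fun p => mul_nonneg (G.nonneg _ _) (sq_nonneg _))] at hle
    have hS : HasSum (fun p : X × X => G.b p.1 p.2 * ((h + t • δ) p.1 - (h + t • δ) p.2) ^ 2)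
        ((∑' p : X × X, G.b p.1 p.2 * (h p.1 - h p.2) ^ 2) + (2 * t) * (2 * T) + t ^ 2 * D) := by
      convert (hfin.summable.hasSum.add (hB.mul_left (2 * t))).add
        (hδfin.summable.hasSum.mul_left (t ^ 2)) using 1
      funext p
      simp only [Pi.add_apply, Pi.smul_apply, smul_eq_mul]
      ring
    rw [hS.tsum_eq] at hle
    linarith
  have hT0 : T = 0 := by
    by_contra hne
    -- A near-optimal t for the quadratic in `hvar`, with D + 1 in place of D to avoid dividing by
    -- zero; its value is negative unless T = 0.
    have h3 := hvar (-(2 * T) / (D + 1))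
    have h4 : -(2 * T) / (D + 1) * (4 * T) + (-(2 * T) / (D + 1)) ^ 2 * D =
        -(4 * T ^ 2 * (D + 2)) / (D + 1) ^ 2 := by
      field_simp
      ring
    rw [h4] at h3
    have h5 : 0 < 4 * T ^ 2 * (D + 2) / (D + 1) ^ 2 := by positivity
    rw [neg_div] at h3
    linarith
  rw [hTdef, sub_eq_zero] at hT0
  rw [← hT0]
  field_simp [hdeg x]

theorem abs_max_min_neg_sub_le (C a b : ℝ) :
    |max (min a C) (-C) - max (min b C) (-C)| ≤ |a - b| := by
  refine (abs_max_sub_max_le_max _ _ _ _).trans (max_le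
    ((abs_min_sub_min_le_max _ _ _ _).trans (max_le le_rfl ?_)) ?_) <;> simp

/-- The Royden decomposition of a bounded function of finite energy, in variational form. -/
theorem exists_bounded_energy_minimizer [Countable X] (G : WeightedGraph X) {f : X → ℝ} {C : ℝ}
    (hf : G.HasFiniteEnergy f) (hC : ∀ x, |f x| ≤ C) :
    ∃ h : X → ℝ, (∀ x, |h x| ≤ C) ∧ G.HasFiniteEnergy h ∧ G.MemClosureFinSupp (f - h) ∧
      ∀ ψ : X → ℝ, (Function.support ψ).Finite → G.energy h ≤ G.energy (h + ψ) := by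
  let I : ℝ≥0∞ := ⨅ g : {g : X → ℝ // (Function.support g).Finite}, G.energy (f - g)
  have hI : ∀ g : X → ℝ, (Function.support g).Finite → I ≤ G.energy (f - g) := fun g hg =>
    iInf_le (fun g : {g : X → ℝ // (Function.support g).Finite} => G.energy (f - g)) ⟨g, hg⟩
  have hItop : I ≠ ∞ := by
    have := hI 0 (by simp)
    rw [sub_zero] at this
    exact (this.trans_lt hf).ne
  let ε : ℕ → ℝ≥0∞ := fun n => ((n : ℝ≥0∞) + 1)⁻¹
  have hε : Tendsto ε atTop (𝓝 0) := by
    have := (tendsto_add_atTop_iff_nat 1).2 ENNReal.tendsto_inv_nat_nhds_zero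
    simpa using this
  have hex : ∀ n, ∃ g : X → ℝ, (Function.support g).Finite ∧ (∀ x, |(f - g) x| ≤ C) ∧
      G.energy (f - g) ≤ I + ε n := fun n => by
    have hlt : I < I + ε n := ENNReal.lt_add_right hItop (ENNReal.inv_ne_zero.2 (by finiteness))
    obtain ⟨⟨g, hg⟩, hgI⟩ := iInf_lt_iff.1 hlt
    -- Truncating f - g at ±C does not raise the energy. Where g vanishes, f is already within the
    -- bounds, so the new correction remains finitely supported.
    refine ⟨fun x => f x - max (min (f x - g x) C) (-C), hg.subset fun x hx => ?_,
      fun x => ?_, (G.energy_mono fun x y => ?_).trans hgI.le⟩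
    · rw [Function.mem_support] at hx ⊢
      contrapose! hx
      have := abs_le.1 (hC x)
      rw [hx, sub_zero, min_eq_left this.2, max_eq_left this.1, sub_self]
    · have hC0 : 0 ≤ C := (abs_nonneg _).trans (hC x)
      simp only [Pi.sub_apply, sub_sub_cancel]
      exact abs_le.2 ⟨le_max_right _ _, max_le (min_le_right _ _) (by linarith)⟩
    · simp only [Pi.sub_apply, sub_sub_cancel]
      exact abs_max_min_neg_sub_le C _ _
  choose g hg hgC hgε using hex
  have hcauchy : ∀ n m, G.energy ((f - g n) - (f - g m)) ≤ 2 * ε n + 2 * ε m := fun n m => by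
    have h1 := G.energy_parallelogram (f - g n) (f - g m)
    -- The midpoint of two competitors is a competitor.
    have h2 : 4 * I ≤ G.energy ((f - g n) + (f - g m)) := by
      have h3 : (f - g n) + (f - g m) = (2 : ℝ) • (f - ((1 / 2 : ℝ) • (g n + g m))) := by
        funext x
        simp only [Pi.add_apply, Pi.sub_apply, Pi.smul_apply, smul_eq_mul]
        ring
      rw [h3, energy_smul, show ENNReal.ofReal (2 ^ 2) = 4 by norm_num]
      gcongr
      exact hI _ ((((hg n).union (hg m)).subset (Function.support_add _ _)).subset
        (Function.support_const_smul_subset _ _))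
    have h4 : G.energy ((f - g n) - (f - g m)) + 4 * I ≤ 2 * ε n + 2 * ε m + 4 * I := by
      calc _ ≤ _ := add_le_add_right h2 _
        _ = _ := h1
        _ ≤ 2 * (I + ε n) + 2 * (I + ε m) := by gcongr <;> exact hgε _
        _ = _ := by ring
    exact (ENNReal.add_le_add_iff_right (ENNReal.mul_ne_top (by simp) hItop)).1 h4
  -- The uniform bound places the sequence in the compact box [-C, C]^X, which is sequentially
  -- compact as X is countable.
  obtain ⟨h, hh, φ, hφ, hlim⟩ := (isCompact_univ_pi fun _ : X => isCompact_Icc (a := -C)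
    (b := C)).tendsto_subseq (x := fun n => f - g n) fun n x _ => abs_le.1 (hgC n x)
  have hlim' : ∀ x, Tendsto (fun k => (f - g (φ k)) x) atTop (𝓝 (h x)) := fun x =>
    (tendsto_pi_nhds.1 hlim) x
  have hεφ : Tendsto (fun k => ε (φ k)) atTop (𝓝 0) := hε.comp hφ.tendsto_atTop
  -- Lower semicontinuity upgrades the Cauchy estimate to energy convergence towards the pointwise
  -- limit.
  have hdist : ∀ n, G.energy ((f - g n) - h) ≤ 2 * ε n := fun n => by
    refine G.energy_le_of_tendsto (f := fun k => (f - g n) - (f - g (φ k)))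
      (c := fun k => 2 * ε n + 2 * ε (φ k)) (fun x => (hlim' x).const_sub _) ?_
      fun k => hcauchy n (φ k)
    simpa using (ENNReal.Tendsto.const_mul hεφ
      (Or.inr (ENNReal.ofNat_ne_top (n := 2)))).const_add (2 * ε n)
  have hdist0 : Tendsto (fun k => G.energy ((f - g (φ k)) - h)) atTop (𝓝 0) := by
    refine tendsto_of_tendsto_of_tendsto_of_le_of_le tendsto_const_nhds (?_ :
      Tendsto (fun k => 2 * ε (φ k)) atTop (𝓝 0)) (fun _ => zero_le) fun k => hdist (φ k)
    simpa using ENNReal.Tendsto.const_mul hεφ (Or.inr (ENNReal.ofNat_ne_top (n := 2)))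
  have hhI : G.energy h ≤ I := by
    refine G.energy_le_of_tendsto hlim' ?_ fun k => hgε (φ k)
    simpa using hεφ.const_add I
  refine ⟨h, fun x => abs_le.2 (hh x trivial), hhI.trans_lt hItop.lt_top, ?_, fun ψ hψ =>
    hhI.trans ?_⟩
  · refine G.memClosureFinSupp_of_tendsto (g := fun k => g (φ k))
      (fun k => G.memClosureFinSupp_of_finite_support (hg _)) ?_ fun x => ?_
    · simpa only [sub_right_comm] using hdist0
    · simpa using (hlim' x).const_sub (f x)
  · have hψtop := G.energy_add_lt_top (hhI.trans_lt hItop.lt_top)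
      (G.hasFiniteEnergy_of_finite_support hψ)
    -- As h is only a limit of competitors f - g (φ k), the function h + ψ is compared with f - (g
    -- (φ k) - ψ): first k → ∞ for fixed t, then t → 0.
    have h1 : ∀ t : ℝ, 0 < t → I ≤ ENNReal.ofReal (1 + t) * G.energy (h + ψ) := fun t ht => by
      have hb : Tendsto (fun k => ENNReal.ofReal (1 + t) * G.energy (h + ψ) +
          ENNReal.ofReal (1 + t⁻¹) * G.energy ((f - g (φ k)) - h)) atTop
          (𝓝 (ENNReal.ofReal (1 + t) * G.energy (h + ψ))) := by
        simpa using (ENNReal.Tendsto.const_mul hdist0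
          (Or.inr (ENNReal.ofReal_ne_top (r := 1 + t⁻¹)))).const_add
          (ENNReal.ofReal (1 + t) * G.energy (h + ψ))
      refine ge_of_tendsto' hb fun k => ?_
      refine le_trans ?_ (G.energy_add_le_mul _ _ ht)
      have h2 : h + ψ + (f - g (φ k) - h) = f - (g (φ k) - ψ) := by
        funext x
        simp only [Pi.add_apply, Pi.sub_apply]
        ring
      rw [h2]
      exact hI _ (((hg (φ k)).union hψ).subset (Function.support_sub _ _))
    have h3 : Tendsto (fun n : ℕ => ENNReal.ofReal (1 + 1 / ((n : ℝ) + 1)) * G.energy (h + ψ))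
        atTop (𝓝 (G.energy (h + ψ))) := by
      have h4 := (ENNReal.continuous_ofReal.tendsto _).comp
        ((tendsto_one_div_add_atTop_nhds_zero_nat (𝕜 := ℝ)).const_add 1)
      simpa using ENNReal.Tendsto.mul_const h4 (Or.inr hψtop.ne)
    exact ge_of_tendsto' h3 fun n => h1 _ (by positivity)

/-- In a connected graph a vertex of degree zero is the only vertex, and then 1 is finitely
supported. -/
theorem deg_ne_zero_of_isTransient (G : WeightedGraph X) (hconn : G.IsConnected)
    (htrans : G.IsTransient) (x : X) : G.deg x ≠ 0 := fun h0 => by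
  have hb : ∀ y, ¬ 0 < G.b x y := fun y hy =>
    hy.ne' (le_antisymm (h0 ▸ (G.summable x).le_tsum y fun z _ => G.nonneg x z) (G.nonneg x y))
  have hx : ∀ y, y = x := fun y => by
    obtain ⟨w⟩ := hconn.preconnected x y
    cases w with
    | nil => rfl
    | cons h _ => exact absurd h (hb _)
  exact htrans (G.memClosureFinSupp_of_finite_support
    ((Set.finite_singleton x).subset fun y _ => hx y))

theorem exists_harmonic_sub_memClosureFinSupp [Countable X] (G : WeightedGraph X)
    (hdeg : ∀ x, G.deg x ≠ 0) {f : X → ℝ} {C : ℝ} (hf : G.HasFiniteEnergy f)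
    (hC : ∀ x, |f x| ≤ C) :
    ∃ h ∈ G.boundedHarmonicFiniteEnergy, G.MemClosureFinSupp (f - h) := by
  obtain ⟨h, hhC, hfin, hmem, hmin⟩ := G.exists_bounded_energy_minimizer hf hC
  exact ⟨h, ⟨G.isHarmonic_of_energy_le hdeg hhC hfin hmin, hfin, C, hhC⟩, hmem⟩

/-! ### Functions built from an intrinsic metric of a finite measure -/

/-- Summing the intrinsic inequality over all vertices bounds the total by 2m(X). -/
theorem IsIntrinsic.tsum_ne_top {G : WeightedGraph X} {m : X → ℝ} {σ : MetricSpace X}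
    (hm : IsFiniteWeight m) (hσ : G.IsIntrinsic m σ) :
    ∑' p : X × X, ENNReal.ofReal (G.b p.1 p.2 * dist p.1 p.2 ^ 2) ≠ ∞ := by
  rw [ENNReal.tsum_prod (f := fun x y => ENNReal.ofReal (G.b x y * dist x y ^ 2))]
  have h1 : ∀ x, ∑' y, ENNReal.ofReal (G.b x y * dist x y ^ 2) ≤ 2 * ENNReal.ofReal (m x) :=
    fun x => by
      have := mul_le_mul_right (hσ x) 2
      rwa [ENNReal.mul_div_cancel (by simp) (by simp)] at this
  refine ((ENNReal.tsum_le_tsum h1).trans_lt ?_).ne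
  rw [ENNReal.tsum_mul_left, ← ENNReal.ofReal_tsum_of_nonneg (fun x => (hm.1 x).le) hm.2]
  exact ENNReal.mul_lt_top (by simp) ENNReal.ofReal_lt_top

theorem hasFiniteEnergy_of_lipschitz (G : WeightedGraph X) [MetricSpace X]
    (hG : ∑' p : X × X, ENNReal.ofReal (G.b p.1 p.2 * dist p.1 p.2 ^ 2) ≠ ∞) {f : X → ℝ} {L : ℝ}
    (hf : ∀ x y, |f x - f y| ≤ L * dist x y) : G.HasFiniteEnergy f := by
  have h1 : 2 * G.energy f ≤ ENNReal.ofReal (L ^ 2) *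
      ∑' p : X × X, ENNReal.ofReal (G.b p.1 p.2 * dist p.1 p.2 ^ 2) := by
    rw [two_mul_energy, ← ENNReal.tsum_mul_left]
    refine ENNReal.tsum_le_tsum fun p => ?_
    rw [← ENNReal.ofReal_mul (sq_nonneg _), mul_left_comm, ← mul_pow]
    exact ENNReal.ofReal_le_ofReal (mul_le_mul_of_nonneg_left
      (sq_le_sq' (neg_le_of_abs_le (hf _ _)) (le_of_abs_le (hf _ _))) (G.nonneg _ _))
  exact (le_mul_of_one_le_left' (by norm_num : (1 : ℝ≥0∞) ≤ 2)).trans_lt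
    (h1.trans_lt (ENNReal.mul_lt_top ENNReal.ofReal_lt_top hG.lt_top))

/-- The distance to a large finite set has small energy. -/
theorem exists_finset_energy_infDist_le (G : WeightedGraph X) [MetricSpace X]
    (hG : ∑' p : X × X, ENNReal.ofReal (G.b p.1 p.2 * dist p.1 p.2 ^ 2) ≠ ∞) (o : X)
    {ε : ℝ≥0∞} (hε : 0 < ε) : ∃ F : Finset X, o ∈ F ∧
      G.energy (fun x => Metric.infDist x (F : Set X)) ≤ ε := by
  classical
  obtain ⟨s, hs⟩ := ((ENNReal.tendsto_tsum_compl_atTop_zero hG).eventually (gt_mem_nhds hε)).exists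
  -- F contains both endpoints of every pair in s, so the distance function has no increment there;
  -- on the other pairs its increment is at most σ, whose weighted square sum is below ε.
  let F : Finset X := insert o (s.image Prod.fst ∪ s.image Prod.snd)
  refine ⟨F, Finset.mem_insert_self _ _, le_trans ?_ hs.le⟩
  refine (le_mul_of_one_le_left' (by norm_num : (1 : ℝ≥0∞) ≤ 2)).trans ?_
  rw [two_mul_energy]
  refine le_trans ?_ (tsum_subtype {p : X × X | p ∉ s}
    (fun p : X × X => ENNReal.ofReal (G.b p.1 p.2 * dist p.1 p.2 ^ 2))).ge
  refine ENNReal.tsum_le_tsum fun p => ?_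
  by_cases hp : p ∈ s
  · have h1 : p.1 ∈ (F : Set X) := Finset.mem_coe.2 (Finset.mem_insert_of_mem
      (Finset.mem_union_left _ (Finset.mem_image_of_mem _ hp)))
    have h2 : p.2 ∈ (F : Set X) := Finset.mem_coe.2 (Finset.mem_insert_of_mem
      (Finset.mem_union_right _ (Finset.mem_image_of_mem _ hp)))
    simp [Metric.infDist_zero_of_mem h1, Metric.infDist_zero_of_mem h2]
  · rw [Set.indicator_of_mem (by exact hp)]
    refine ENNReal.ofReal_le_ofReal (mul_le_mul_of_nonneg_left ?_ (G.nonneg _ _))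
    rw [sq_le_sq, abs_of_nonneg (dist_nonneg (x := p.1)), ← Real.dist_eq]
    simpa using (Metric.lipschitz_infDist_pt (F : Set X)).dist_le_mul p.1 p.2

/-- An increment of the maximum is at most the larger of the two increments. The constant 1 is what
lets countably many functions be combined with summable energies. -/
theorem energy_max_le (G : WeightedGraph X) (f g : X → ℝ) :
    G.energy (fun x => max (f x) (g x)) ≤ G.energy f + G.energy g := by
  unfold energy
  rw [← ENNReal.add_div]
  gcongr ?_ / 2
  rw [← ENNReal.tsum_add]
  refine ENNReal.tsum_le_tsum fun x => ?_
  rw [← ENNReal.tsum_add]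
  refine ENNReal.tsum_le_tsum fun y => ?_
  have hb := G.nonneg x y
  rw [← ENNReal.ofReal_add (by positivity) (by positivity), ← mul_add]
  refine ENNReal.ofReal_le_ofReal (mul_le_mul_of_nonneg_left ?_ hb)
  rw [← sq_abs (max _ _ - _), ← sq_abs (f x - f y), ← sq_abs (g x - g y)]
  have h := abs_max_sub_max_le_max (f x) (g x) (f y) (g y)
  rcases le_total |f x - f y| |g x - g y| with h1 | h1
  · rw [max_eq_right h1] at h
    nlinarith [abs_nonneg (max (f x) (g x) - max (f y) (g y)), sq_nonneg |f x - f y|]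
  · rw [max_eq_left h1] at h
    nlinarith [abs_nonneg (max (f x) (g x) - max (f y) (g y)), sq_nonneg |g x - g y|]

/-- There are functions of small energy that equal `1` off totally bounded sets. -/
theorem exists_energy_lt_totallyBounded (G : WeightedGraph X) [MetricSpace X]
    (hG : ∑' p : X × X, ENNReal.ofReal (G.b p.1 p.2 * dist p.1 p.2 ^ 2) ≠ ∞) (o : X)
    {ε : ℝ≥0∞} (hε : 0 < ε) : ∃ v : X → ℝ, (∀ x, 0 ≤ v x) ∧ (∀ x, v x ≤ 1) ∧ v o = 0 ∧
      G.energy v < ε ∧ TotallyBounded {x | v x < 1} := by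
  obtain ⟨δ, hδ, hδε⟩ := ENNReal.exists_pos_sum_of_countable' hε.ne' ℕ
  have hc : ∀ k : ℕ, ENNReal.ofReal ((2 ^ k) ^ 2) ≠ 0 := fun k => by
    rw [Ne, ENNReal.ofReal_eq_zero, not_le]; positivity
  -- The tolerance δ k / 4^k compensates the later scaling of the distance by 2^k.
  choose F hoF hF using fun k : ℕ => G.exists_finset_energy_infDist_le hG o
    (ENNReal.div_pos (hδ k).ne' (ENNReal.ofReal_ne_top (r := ((2 : ℝ) ^ k) ^ 2)))
  let a : ℕ → X → ℝ := fun k x => min 1 (2 ^ k * Metric.infDist x (F k : Set X))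
  have ha : ∀ k, G.energy (a k) ≤ δ k := fun k => by
    refine (G.energy_mono (g := (2 : ℝ) ^ k • fun x => Metric.infDist x (F k : Set X))
      fun x y => ?_).trans ?_
    · refine (abs_min_sub_min_le_max _ _ _ _).trans (max_le ?_ le_rfl)
      simp
    · rw [energy_smul]
      refine (mul_le_mul_right (hF k) _).trans ?_
      rw [ENNReal.mul_div_cancel (hc k) ENNReal.ofReal_ne_top]
  -- `w n` is the maximum of 0 and the `a k` with k < n, so `a k` first enters at `w (k + 1)`.
  let w : ℕ → X → ℝ := fun n => Nat.rec (fun _ => 0) (fun k u x => max (u x) (a k x)) n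
  have hw1 : ∀ n x, w n x ≤ 1 := fun n x => by
    induction n with
    | zero => exact zero_le_one
    | succ k ih => exact max_le ih (min_le_left _ _)
  have hmono : ∀ x, Monotone fun n => w n x := fun x =>
    monotone_nat_of_le_succ fun n => le_max_left _ _
  have hwo : ∀ n, w n o = 0 := fun n => by
    induction n with
    | zero => rfl
    | succ k ih =>
      change max (w k o) (a k o) = 0
      simp [ih, a, Metric.infDist_zero_of_mem (Finset.mem_coe.2 (hoF k))]
  have hwE : ∀ n, G.energy (w n) ≤ ∑' k, δ k := fun n => by
    refine le_trans ?_ (ENNReal.sum_le_tsum (Finset.range n))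
    induction n with
    | zero => simp [w, energy]
    | succ k ih =>
      rw [Finset.sum_range_succ]
      exact (G.energy_max_le (w k) (a k)).trans (add_le_add ih (ha k))
  have hbdd : ∀ x, BddAbove (Set.range fun n => w n x) := fun x =>
    ⟨1, by rintro _ ⟨n, rfl⟩; exact hw1 n x⟩
  have hlim : ∀ x, Tendsto (fun n => w n x) atTop (𝓝 (⨆ n, w n x)) := fun x =>
    tendsto_atTop_ciSup (hmono x) (hbdd x)
  refine ⟨fun x => ⨆ n, w n x, fun x => le_ciSup (hbdd x) 0, fun x => ciSup_le fun n => hw1 n x,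
    by simp [hwo], (G.energy_le_of_tendsto hlim tendsto_const_nhds hwE).trans_lt hδε, ?_⟩
  refine Metric.totallyBounded_iff.2 fun r hr => ?_
  -- If v x < 1 then `a k x` < 1, so x is within 2^(-k) < r of `F k`: the finite set `F k` is an
  -- r-net.
  obtain ⟨k, hk⟩ := exists_pow_lt_of_lt_one hr (by norm_num : (1 / 2 : ℝ) < 1)
  refine ⟨F k, (F k).finite_toSet, fun x hx => ?_⟩
  have h1 : a k x < 1 := lt_of_le_of_lt ((le_max_right (w k x) _).trans (le_ciSup (hbdd x) (k + 1)))
    hx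
  have h2 : 2 ^ k * Metric.infDist x (F k : Set X) < 1 := by
    rcases min_lt_iff.1 h1 with h | h
    · exact absurd h (lt_irrefl _)
    · exact h
  have h3 : Metric.infDist x (F k : Set X) < r := by
    refine lt_of_le_of_lt ?_ hk
    rw [one_div, inv_pow, ← one_div, le_div_iff₀ (by positivity), mul_comm]
    exact h2.le
  obtain ⟨y, hy, hxy⟩ := (Metric.infDist_lt_iff ⟨o, Finset.mem_coe.2 (hoF k)⟩).1 h3
  exact Set.mem_iUnion₂.2 ⟨y, hy, hxy⟩

/-! ### Localisation at points of capacity zero -/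

/-- Cutoff functions witnessing that a point of the completion has capacity zero. -/
theorem exists_cutoff_of_capCompletion_eq_zero (G : WeightedGraph X) {m : X → ℝ}
    (hm : IsFiniteWeight m) {σ : MetricSpace X} {p : UniformSpace.Completion X}
    (hp : G.capCompletion m σ {p} = 0) (o : X) {ε : ℝ} (hε : 0 < ε) :
    ∃ (O : Set (UniformSpace.Completion X)) (e : X → ℝ), IsOpen O ∧ p ∈ O ∧ (∀ x, 0 ≤ e x) ∧
      (∀ x, e x ≤ 1) ∧ (∀ x : X, (x : UniformSpace.Completion X) ∈ O → e x = 1) ∧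
      G.energy e < ENNReal.ofReal ε ∧ e o ^ 2 < ε := by
  have hmo := hm.1 o
  -- The bound m(o)ε controls the value at o, because m(o) f(o)² is one term of the Sobolev norm.
  have hpos : G.capCompletion m σ {p} < ENNReal.ofReal (min ε (m o * ε)) := by
    rw [hp]; exact ENNReal.ofReal_pos.2 (lt_min hε (mul_pos hmo hε))
  simp only [capCompletion, cap, iInf_lt_iff] at hpos
  obtain ⟨O, hO, hpO, f, hf, hf1, hlt⟩ := hpos
  have hE : G.energy (fun x => max 0 (min 1 (f x))) ≤ G.energy f := G.energy_mono fun x y => by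
    refine (abs_max_sub_max_le_max _ _ _ _).trans (max_le (by simp)
      ((abs_min_sub_min_le_max _ _ _ _).trans (max_le (by simp) le_rfl)))
  refine ⟨O, fun x => max 0 (min 1 (f x)), hO, hpO rfl, fun x => le_max_left _ _,
    fun x => max_le zero_le_one (min_le_left _ _), fun x hx => ?_, ?_, ?_⟩
  · simp [min_eq_left (hf1 x hx)]
  · exact hE.trans_lt ((le_add_self.trans_lt hlt).trans_le
      (ENNReal.ofReal_le_ofReal (min_le_left _ _)))
  · have h1 : ENNReal.ofReal (m o * |f o| ^ 2) < ENNReal.ofReal (m o * ε) :=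
      ((ENNReal.le_tsum o).trans (le_self_add (a := ∑' x, ENNReal.ofReal (m x * |f x| ^ 2))
        (b := G.energy f))).trans_lt (hlt.trans_le (ENNReal.ofReal_le_ofReal (min_le_right _ _)))
    have h2 := lt_of_mul_lt_mul_left (ENNReal.ofReal_lt_ofReal_iff_of_nonneg
      (by positivity) |>.1 h1) hmo.le
    refine lt_of_le_of_lt ?_ h2
    refine pow_le_pow_left₀ (le_max_left _ _) (max_le (abs_nonneg _) ?_) 2
    exact (min_le_right _ _).trans (le_abs_self _)

/-- The Leibniz rule for increments: it bounds the energy of a cutoff times a bounded function. -/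
theorem abs_mul_sub_mul_le {C a b u v : ℝ} (hu : |u| ≤ 1) (hb : |b| ≤ C) :
    |u * a - v * b| ≤ |a - b| + |C * u - C * v| := by
  have h1 : u * a - v * b = u * (a - b) + b * (u - v) := by ring
  rw [h1, ← mul_sub, abs_mul C]
  refine (abs_add_le _ _).trans (add_le_add ?_ ?_)
  · rw [abs_mul]
    exact mul_le_of_le_one_left (abs_nonneg _) hu
  · rw [abs_mul]
    exact mul_le_mul_of_nonneg_right (hb.trans (le_abs_self C)) (abs_nonneg _)

/-- A bounded function of finite energy belongs to `𝔇₀(G)` if, off sets of arbitrarily small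
capacity, it agrees with elements of `𝔇₀(G)`. -/
theorem memClosureFinSupp_of_eq_off (G : WeightedGraph X) (hconn : G.IsConnected) {h : X → ℝ}
    {C : ℝ} (hC : ∀ x, |h x| ≤ C) (hfin : G.HasFiniteEnergy h) {e g : ℕ → X → ℝ}
    (he0 : ∀ n x, 0 ≤ e n x) (he1 : ∀ n x, e n x ≤ 1)
    (heE : ∀ n, G.HasFiniteEnergy (e n))
    (hE : Tendsto (fun n => G.energy (e n)) atTop (𝓝 0))
    (he : ∀ x, Tendsto (fun n => e n x) atTop (𝓝 0))
    (hg : ∀ n, G.MemClosureFinSupp (g n)) (heq : ∀ n x, e n x = 1 ∨ h x = g n x) :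
    G.MemClosureFinSupp h := by
  have habs : ∀ n x, |e n x| ≤ 1 := fun n x => by rw [abs_of_nonneg (he0 n x)]; exact he1 n x
  have heh : ∀ n, G.HasFiniteEnergy (fun x => e n x * h x) := fun n =>
    (G.energy_le_of_abs_sub_le (g := h) (k := C • e n) fun x y =>
      abs_mul_sub_mul_le (habs n x) (hC y)).trans_lt (ENNReal.add_lt_top.2
      ⟨ENNReal.mul_lt_top (by simp) hfin,
        ENNReal.mul_lt_top (by simp) (G.energy_smul_lt_top C (heE n))⟩)
  -- (1 - e n)h vanishes where e n = 1 and is dominated by |g n| elsewhere, so the ideal property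
  -- applies.
  refine G.memClosureFinSupp_of_tendsto (g := fun n => h - fun x => e n x * h x)
    (fun n => (hg n).of_abs_le hconn (G.energy_sub_lt_top hfin (heh n)) fun x => ?_) ?_
    fun x => ?_
  · rcases heq n x with h1 | h1
    · simp [h1]
    · rw [← h1]
      have : (h - fun x => e n x * h x) x = (1 - e n x) * h x := by
        simp only [Pi.sub_apply]; ring
      rw [this, abs_mul]
      refine mul_le_of_le_one_left (abs_nonneg _) (abs_le.2 ⟨?_, ?_⟩) <;>
        linarith [he0 n x, he1 n x]
  · simp only [sub_sub_cancel]
    refine G.tendsto_energy_zero_of_dominated (a := h) (c := 0) (s := fun n => C • e n)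
      (fun x => ?_) hfin (by simp [HasFiniteEnergy, energy]) ?_ fun n x y => ?_
    · simpa using (he x).mul_const (h x)
    · simp only [energy_smul]
      simpa using ENNReal.Tendsto.const_mul hE (Or.inr (ENNReal.ofReal_ne_top (r := C ^ 2)))
    · simpa using abs_mul_sub_mul_le (habs n x) (hC y)
  · simpa using ((he x).mul_const (h x)).const_sub (h x)

/-- The bounded harmonic functions of finite energy that agree off `U` with an element of
`𝔇₀(G)`. -/
def harmonicAgreeingOff (G : WeightedGraph X) (hconn : G.IsConnected) (U : Set X) :
    Submodule ℝ G.boundedHarmonicFiniteEnergy where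
  carrier := {h | ∃ g, G.MemClosureFinSupp g ∧ ∀ x ∉ U, (h : X → ℝ) x = g x}
  zero_mem' := ⟨0, G.memClosureFinSupp_of_finite_support (by simp), fun _ _ => rfl⟩
  add_mem' := by
    rintro h k ⟨g, hg, hg'⟩ ⟨u, hu, hu'⟩
    exact ⟨g + u, hg.add hconn hu, fun x hx => congrArg₂ (· + ·) (hg' x hx) (hu' x hx)⟩
  smul_mem' := by
    rintro c h ⟨g, hg, hg'⟩
    exact ⟨c • g, hg.smul hconn c, fun x hx => congrArg (c * ·) (hg' x hx)⟩

theorem harmonicAgreeingOff_mono (G : WeightedGraph X) (hconn : G.IsConnected) {U V : Set X}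
    (hUV : U ⊆ V) : G.harmonicAgreeingOff hconn U ≤ G.harmonicAgreeingOff hconn V :=
  fun _ ⟨g, hg, hg'⟩ => ⟨g, hg, fun x hx => hg' x fun hxU => hx (hUV hxU)⟩

/-- If the space of bounded harmonic functions of finite energy is finite dimensional, then
functions supported near a point of capacity zero belong to `𝔇₀(G)`. -/
theorem exists_isOpen_memClosureFinSupp [Countable X] (G : WeightedGraph X)
    (hconn : G.IsConnected) (hdeg : ∀ x, G.deg x ≠ 0)
    [FiniteDimensional ℝ G.boundedHarmonicFiniteEnergy] {m : X → ℝ}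
    (hm : IsFiniteWeight m) {σ : MetricSpace X} {p : UniformSpace.Completion X}
    (hp : G.capCompletion m σ {p} = 0) :
    ∃ U : Set (UniformSpace.Completion X), IsOpen U ∧ p ∈ U ∧ ∀ (η : X → ℝ) (C : ℝ),
      G.HasFiniteEnergy η → (∀ x, |η x| ≤ C) →
      (∀ x : X, (x : UniformSpace.Completion X) ∉ U → η x = 0) → G.MemClosureFinSupp η := by
  let V : Set (UniformSpace.Completion X) → Submodule ℝ G.boundedHarmonicFiniteEnergy :=
    fun U => G.harmonicAgreeingOff hconn ((fun x : X => (x : UniformSpace.Completion X)) ⁻¹' U)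
  -- Finite dimension enters here, through the descending chain condition. Intersecting U with O
  -- turns a minimal V U into a least one.
  obtain ⟨_, ⟨U, ⟨hU, hpU⟩, rfl⟩, hmin⟩ := WellFounded.has_min
    (wellFounded_lt (α := Submodule ℝ G.boundedHarmonicFiniteEnergy))
    (V '' {U | IsOpen U ∧ p ∈ U}) ⟨_, Set.univ, ⟨isOpen_univ, trivial⟩, rfl⟩
  have hle : ∀ O, IsOpen O → p ∈ O → V U ≤ V O := fun O hO hpO => by
    have h1 : V (U ∩ O) ≤ V U :=
      G.harmonicAgreeingOff_mono hconn (Set.preimage_mono Set.inter_subset_left)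
    have h2 : V (U ∩ O) ≤ V O :=
      G.harmonicAgreeingOff_mono hconn (Set.preimage_mono Set.inter_subset_right)
    have h3 := hmin _ ⟨U ∩ O, ⟨hU.inter hO, hpU, hpO⟩, rfl⟩
    exact (eq_of_le_of_not_lt h1 h3).ge.trans h2
  refine ⟨U, hU, hpU, fun η C hηfin hηC hη => ?_⟩
  obtain ⟨h, hh, hηh⟩ := G.exists_harmonic_sub_memClosureFinSupp hdeg hηfin hηC
  suffices hD : G.MemClosureFinSupp h by
    simpa using hηh.add hconn hD
  -- Off U, η vanishes, so there h equals -(η - h), an element of 𝔇₀.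
  have hhU : (⟨h, hh⟩ : G.boundedHarmonicFiniteEnergy) ∈ V U :=
    ⟨_, hηh.smul hconn (-1), fun x hx => by simp [hη x hx]⟩
  obtain ⟨o⟩ := hconn.nonempty
  choose O e hO hpO he0 he1 heO heE heo using fun n : ℕ =>
    G.exists_cutoff_of_capCompletion_eq_zero hm hp o (Nat.one_div_pos_of_nat (α := ℝ) (n := n))
  choose g hg hgO using fun n => hle (O n) (hO n) (hpO n) hhU
  have hlim := tendsto_one_div_add_atTop_nhds_zero_nat (𝕜 := ℝ)
  have hE : Tendsto (fun n => G.energy (e n)) atTop (𝓝 0) := by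
    refine tendsto_of_tendsto_of_tendsto_of_le_of_le tendsto_const_nhds (?_ :
      Tendsto (fun n : ℕ => ENNReal.ofReal (1 / ((n : ℝ) + 1))) atTop (𝓝 0))
      (fun _ => zero_le) fun n => (heE n).le
    simpa [Function.comp_def] using (ENNReal.continuous_ofReal.tendsto _).comp hlim
  have heo' : Tendsto (fun n => e n o) atTop (𝓝 0) := by
    have h1 : Tendsto (fun n => e n o ^ 2) atTop (𝓝 0) :=
      squeeze_zero (fun n => sq_nonneg _) (fun n => (heo n).le) hlim
    have h2 := (Real.continuous_sqrt.tendsto _).comp h1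
    rw [Real.sqrt_zero] at h2
    exact h2.congr fun n => Real.sqrt_sq (he0 n o)
  obtain ⟨D, hD⟩ := hh.2.2
  refine G.memClosureFinSupp_of_eq_off hconn hD hh.2.1 he0 he1
    (fun n => (heE n).trans ENNReal.ofReal_lt_top) hE
    (G.tendsto_zero_of_tendsto_energy hconn hE heo') hg fun n x => ?_
  by_cases hx : (x : UniformSpace.Completion X) ∈ O n
  · exact Or.inl (heO n x hx)
  · exact Or.inr (hgO n x hx)

/-! ### Bump functions, compactness and recurrence -/

/-- A Lipschitz bump function on the completion, restricted to the vertices. -/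
theorem exists_bump (G : WeightedGraph X) [MetricSpace X]
    (hG : ∑' p : X × X, ENNReal.ofReal (G.b p.1 p.2 * dist p.1 p.2 ^ 2) ≠ ∞)
    {p : UniformSpace.Completion X} {U : Set (UniformSpace.Completion X)} (hU : U ∈ 𝓝 p) :
    ∃ η : X → ℝ, ∃ W ∈ 𝓝 p, G.HasFiniteEnergy η ∧ (∀ x, 0 ≤ η x) ∧ (∀ x, η x ≤ 1) ∧
      (∀ x : X, (x : UniformSpace.Completion X) ∉ U → η x = 0) ∧
      ∀ x : X, (x : UniformSpace.Completion X) ∈ W → 1 ≤ η x := by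
  obtain ⟨r, hr, hrU⟩ := Metric.mem_nhds_iff.1 hU
  -- The slope 2 / r makes the profile fall from 1 at distance r / 2 to 0 at distance r.
  let η : X → ℝ := fun x => max 0 (min 1 (2 - 2 / r * dist (x : UniformSpace.Completion X) p))
  refine ⟨η, Metric.ball p (r / 2), Metric.ball_mem_nhds p (half_pos hr),
    G.hasFiniteEnergy_of_lipschitz hG (L := 2 / r) fun x y => ?_, fun x => le_max_left _ _,
    fun x => max_le zero_le_one (min_le_left _ _), fun x hx => ?_, fun x hx => ?_⟩
  · refine (abs_max_sub_max_le_max _ _ _ _).trans (max_le (by simp; positivity)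
      ((abs_min_sub_min_le_max _ _ _ _).trans (max_le (by simp; positivity) ?_)))
    rw [sub_sub_sub_cancel_left, ← mul_sub, abs_mul, abs_of_pos (by positivity : 0 < 2 / r),
      abs_sub_comm]
    refine mul_le_mul_of_nonneg_left ?_ (by positivity)
    rw [← UniformSpace.Completion.dist_eq x y]
    exact abs_dist_sub_le (x : UniformSpace.Completion X) (y : UniformSpace.Completion X) p
  · have h1 : r ≤ dist (x : UniformSpace.Completion X) p := by
      by_contra! h
      exact hx (hrU h)
    have h2 : 2 - 2 / r * dist (x : UniformSpace.Completion X) p ≤ 0 := by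
      have : 2 / r * r ≤ 2 / r * dist (x : UniformSpace.Completion X) p :=
        mul_le_mul_of_nonneg_left h1 (by positivity)
      rw [div_mul_cancel₀ _ hr.ne'] at this
      linarith
    exact max_eq_left ((min_le_right _ _).trans h2)
  · have h1 : 2 / r * dist (x : UniformSpace.Completion X) p ≤ 2 / r * (r / 2) :=
      mul_le_mul_of_nonneg_left (le_of_lt hx) (by positivity)
    have h2 : 2 / r * (r / 2) = 1 := by field_simp
    exact le_max_of_le_right (le_min le_rfl (by linarith))

/-- On a connected strongly resolvable graph, if the bounded harmonic functions of finite energy form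
a finite dimensional space, then the graph is recurrent. Neither local finiteness nor total
boundedness is needed, as `exists_energy_lt_totallyBounded` provides the required compactness. -/
theorem isRecurrent_of_finiteDimensional [Countable X] (G : WeightedGraph X)
    (hconn : G.IsConnected) (hdeg : ∀ x, G.deg x ≠ 0) (hres : G.IsStronglyResolvable)
    [FiniteDimensional ℝ G.boundedHarmonicFiniteEnergy] : G.IsRecurrent := by
  obtain ⟨σ, hdisc, m, hm, hint, hcap⟩ := hres
  have hG := hint.tsum_ne_top hm
  have hloc : ∀ p : UniformSpace.Completion X, ∃ η : X → ℝ, ∃ W ∈ 𝓝 p,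
      G.MemClosureFinSupp η ∧ (∀ x, 0 ≤ η x) ∧
      ∀ x : X, (x : UniformSpace.Completion X) ∈ W → 1 ≤ η x := fun p => by
    by_cases hp : p ∈ metricBoundary σ
    · obtain ⟨U, hU, hpU, hUη⟩ := G.exists_isOpen_memClosureFinSupp hconn hdeg hm (hcap p hp)
      obtain ⟨η, W, hW, hfin, h0, h1, hη, hηW⟩ := G.exists_bump hG (hU.mem_nhds hpU)
      exact ⟨η, W, hW, hUη η 1 hfin (fun x => by rw [abs_of_nonneg (h0 x)]; exact h1 x) hη, h0, hηW⟩
    · obtain ⟨y, rfl⟩ := not_not.1 hp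
      -- Discreteness makes {y} the trace on X of an open set of the completion, so the indicator of
      -- y serves there.
      obtain ⟨W, hW, hWy⟩ := (UniformSpace.Completion.isUniformInducing_coe X).isInducing.isOpen_iff.1
        (isOpen_discrete ({y} : Set X))
      refine ⟨Set.indicator {y} 1, W, hW.mem_nhds ?_, G.memClosureFinSupp_of_finite_support
        ((Set.finite_singleton y).subset Set.support_indicator_subset),
        fun x => Set.indicator_nonneg (fun _ _ => zero_le_one) x, fun x hx => ?_⟩
      · exact (hWy.ge (Set.mem_singleton y) :)
      · rw [Set.indicator_of_mem (hWy.le hx)]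
        rfl
  choose η W hW hη h0 hηW using hloc
  obtain ⟨o⟩ := hconn.nonempty
  choose v hv0 hv1 hvo hvE hvT using fun n : ℕ => G.exists_energy_lt_totallyBounded hG o
    (ENNReal.ofReal_pos.2 (Nat.one_div_pos_of_nat (α := ℝ) (n := n)))
  have hE : Tendsto (fun n => G.energy (v n)) atTop (𝓝 0) := by
    refine tendsto_of_tendsto_of_tendsto_of_le_of_le tendsto_const_nhds (?_ :
      Tendsto (fun n : ℕ => ENNReal.ofReal (1 / ((n : ℝ) + 1))) atTop (𝓝 0))
      (fun _ => zero_le) fun n => (hvE n).le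
    simpa [Function.comp_def] using (ENNReal.continuous_ofReal.tendsto _).comp
      (tendsto_one_div_add_atTop_nhds_zero_nat (𝕜 := ℝ))
  refine G.memClosureFinSupp_of_tendsto (g := fun n x => 1 - v n x) (fun n => ?_) ?_ fun x => ?_
  · have hK : IsCompact (closure ((fun x : X => (x : UniformSpace.Completion X)) ''
        {x | v n x < 1})) :=
      ((hvT n).image (UniformSpace.Completion.uniformContinuous_coe X)).closure.isCompact_of_isClosed
        isClosed_closure
    -- On {v n < 1} some η p with p in t is at least 1; elsewhere 1 - v n ≤ 0. Hence the finite sum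
    -- dominates 1 - v n.
    obtain ⟨t, -, ht⟩ := hK.elim_nhds_subcover W fun p _ => hW p
    refine (memClosureFinSupp_sum hconn t η fun p _ => hη p).of_abs_le hconn ?_ fun x => ?_
    · exact lt_of_le_of_lt (G.energy_mono (g := v n) fun x y => by
        rw [sub_sub_sub_cancel_left, abs_sub_comm]) ((hvE n).trans ENNReal.ofReal_lt_top)
    · rw [Finset.sum_apply, abs_of_nonneg (Finset.sum_nonneg fun p _ => h0 p x),
        abs_of_nonneg (sub_nonneg.2 (hv1 n x))]
      by_cases hx : v n x < 1
      · obtain ⟨p, hpt, hp⟩ := Set.mem_iUnion₂.1 (ht (subset_closure (Set.mem_image_of_mem _ hx)))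
        calc 1 - v n x ≤ 1 := by linarith [hv0 n x]
          _ ≤ η p x := hηW p x hp
          _ ≤ _ := Finset.single_le_sum (f := fun p => η p x) (fun p _ => h0 p x) hpt
      · exact le_trans (by linarith) (Finset.sum_nonneg fun p _ => h0 p x)
  · refine hE.congr fun n => ?_
    congr 1
    funext x
    simp
  · simpa using (G.tendsto_zero_of_tendsto_energy hconn hE
      (o := o) (by simp [hvo]) x).const_sub 1

end WeightedGraph

theorem mainTheorem7 {X : Type*} [Countable X] (G : WeightedGraph X)
    (hconn : G.IsConnected) (htrans : G.IsTransient) (hres : G.IsStronglyResolvable)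
    (h : G.IsLocallyFinite ∨
      ∃ σ : MetricSpace X, G.IsResolvingMetric σ ∧ TotallyBounded (Set.univ : Set X)) :
    ¬ FiniteDimensional ℝ G.boundedHarmonicFiniteEnergy := fun _ =>
  htrans (G.isRecurrent_of_finiteDimensional hconn
    (G.deg_ne_zero_of_isTransient hconn htrans) hres)
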